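/- For subspaces $U,V$ of $\mathbb{F}_2^n$ let $d_S(U,V)=\dim(U+V)-\dim(U\cap V)$ be the subspace distance, and let $A_2(n,d;k)$ denote the maximum cardinality of a set of $k$-dimensional subspaces of $\mathbb{F}_2^n$ such that any two distinct members $U,V$ satisfy $d_S(U,V)\ge d$. (Thus, for $k\ge 1$, $A_2(n,2k;k)$ is the maximum size of a partial $k$-spread in $\mathbb{F}_2^n$, i.e., of a set of $k$-dimensional subspaces with pairwise trivial intersection.) For every integer $k\ge 4$ we have $$A_2(2k+2,2k;k)=2^{k+2}+1.$$ -/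

import Mathlib

/-- The subspace distance `d_S(U, V) = dim (U + V) - dim (U ∩ V)`.  The subtraction is never
truncated, because `U ∩ V` is contained in `U + V`. -/
noncomputable def subspaceDist {K : Type*} [Field K] {n : ℕ}
    (U V : Submodule K (Fin n → K)) : ℕ :=
  Module.finrank K (U ⊔ V : Submodule K (Fin n → K)) -
    Module.finrank K (U ⊓ V : Submodule K (Fin n → K))

/-- `C` is a subspace code in `K ^ n` with minimum subspace distance at least `d`, all of whose
codewords have a dimension in `D`. -/
def IsSubspaceCode (K : Type*) [Field K] (n d : ℕ) (D : Set ℕ)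
    (C : Finset (Submodule K (Fin n → K))) : Prop :=
  (∀ U ∈ C, Module.finrank K U ∈ D) ∧
    ∀ U ∈ C, ∀ V ∈ C, U ≠ V → d ≤ subspaceDist U V

/-- `A_q(n, d; D)`, for `K` the field with `q` elements: the maximum cardinality of a subspace
code in `K ^ n` with minimum subspace distance at least `d` and dimensions in `D`. -/
noncomputable def maxSubspaceCode (K : Type*) [Field K] [Finite K] (n d : ℕ) (D : Set ℕ) : ℕ :=
  sSup {N : ℕ | ∃ C : Finset (Submodule K (Fin n → K)), IsSubspaceCode K n d D C ∧ C.card = N}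

/-- The supremum in the definition of `maxSubspaceCode` is an attained maximum. -/
theorem isGreatest_maxSubspaceCode (K : Type*) [Field K] [Finite K] (n d : ℕ) (D : Set ℕ) :
    IsGreatest
      {N : ℕ | ∃ C : Finset (Submodule K (Fin n → K)), IsSubspaceCode K n d D C ∧ C.card = N}
      (maxSubspaceCode K n d D) := by
  have hb : BddAbove
      {N : ℕ | ∃ C : Finset (Submodule K (Fin n → K)),
        IsSubspaceCode K n d D C ∧ C.card = N} := by
    haveI : Finite (Submodule K (Fin n → K)) :=
      Finite.of_injective (fun U : Submodule K (Fin n → K) => (U : Set (Fin n → K)))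
        SetLike.coe_injective
    haveI := Fintype.ofFinite (Submodule K (Fin n → K))
    refine ⟨Fintype.card (Submodule K (Fin n → K)), ?_⟩
    rintro N ⟨C, -, rfl⟩
    exact Finset.card_le_univ C
  exact ⟨Nat.sSup_mem ⟨0, ∅, by simp [IsSubspaceCode], rfl⟩ hb, fun N hN => le_csSup hb hN⟩

/-! Upper bound: with `2 ^ (k+2) + 2` members, the vectors left uncovered (holes) form a `2 ^
(k-1)`-divisible set of size `4 * 2 ^ (k-1) + 1`. Passing to a hyperplane with fewer than half the
points halves the divisibility and keeps the size modulo the old divisor. At most two passes reach a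
single point that is still at least `2 ^ (k-3)`-divisible, impossible since `k ≥ 4`
(`card_ne_four_mul_add_one`, `card_partialSpread_le`). Lower bound: graphs of multiplications in the
field with `2 ^ (k+2)` elements, plus one vertical subspace (`exists_partialSpread`). -/

open scoped Classical in
/-- The number of elements of `S` outside the kernel of `φ`. -/
noncomputable def hyperplaneWeight {V : Type*} [AddCommGroup V] [Module (ZMod 2) V]
    (S : Finset V) (φ : V →ₗ[ZMod 2] ZMod 2) : ℕ :=
  (S.filter fun x => φ x = 1).card

/-- Every hyperplane misses a multiple of `Δ` elements of `S`. -/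
def IsDivisibleSet {V : Type*} [AddCommGroup V] [Module (ZMod 2) V]
    (Δ : ℕ) (S : Finset V) : Prop :=
  ∀ φ : V →ₗ[ZMod 2] ZMod 2, Δ ∣ hyperplaneWeight S φ

theorem ZMod.two_eq_zero_or_one (a : ZMod 2) : a = 0 ∨ a = 1 := by
  revert a; decide

/-! ### Binary divisible sets and their possible sizes -/

section Divisible

variable {V : Type*} [AddCommGroup V] [Module (ZMod 2) V]

theorem two_mul_hyperplaneWeight_univ [Fintype V] {φ : V →ₗ[ZMod 2] ZMod 2} (hφ : φ ≠ 0) :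
    2 * hyperplaneWeight Finset.univ φ = Fintype.card V := by
  classical
  obtain ⟨u, hu⟩ : ∃ u, φ u = 1 := by
    by_contra! h
    exact hφ (LinearMap.ext fun x => (ZMod.two_eq_zero_or_one _).resolve_right (h x))
  have h10 : ((1 : ZMod 2) + 1) = 0 := by decide
  have hbij : (Finset.univ.filter fun x => φ x = 1).card
      = (Finset.univ.filter fun x => ¬ φ x = 1).card := by
    refine Finset.card_bij' (fun x _ => x + u) (fun x _ => x - u) ?_ ?_ ?_ ?_
    · intro x hx
      simp only [Finset.mem_filter, Finset.mem_univ, true_and] at hx ⊢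
      rw [map_add, hx, hu, h10]; decide
    · intro x hx
      simp only [Finset.mem_filter, Finset.mem_univ, true_and] at hx ⊢
      rw [map_sub, hu, (ZMod.two_eq_zero_or_one _).resolve_right hx]; decide
    · intros; simp
    · intros; simp
  have h := Finset.card_filter_add_card_filter_not (s := (Finset.univ : Finset V))
    (fun x => φ x = 1)
  rw [Finset.card_univ] at h
  unfold hyperplaneWeight
  rw [← h, ← hbij, two_mul]

/-- Averaging: each nonzero vector takes the value 1 under exactly half of all functionals. The zero
functional has weight 0, which makes the inequality strict for another one. -/
theorem exists_card_lt_two_mul_hyperplaneWeight [Finite V] {S : Finset V} (h0 : (0 : V) ∉ S)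
    (hS : S.Nonempty) : ∃ φ : V →ₗ[ZMod 2] ZMod 2, S.card < 2 * hyperplaneWeight S φ := by
  classical
  have : Finite (V →ₗ[ZMod 2] ZMod 2) := DFunLike.finite _
  let _ := Fintype.ofFinite (V →ₗ[ZMod 2] ZMod 2)
  by_contra! h
  have hlt : ∑ φ : V →ₗ[ZMod 2] ZMod 2, 2 * hyperplaneWeight S φ
      < ∑ _φ : V →ₗ[ZMod 2] ZMod 2, S.card := by
    refine Finset.sum_lt_sum (fun φ _ => h φ) ⟨0, Finset.mem_univ _, ?_⟩
    simpa [hyperplaneWeight] using hS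
  have hx : ∀ x ∈ S, 2 * (Finset.univ.filter fun φ : V →ₗ[ZMod 2] ZMod 2 => φ x = 1).card
      = Fintype.card (V →ₗ[ZMod 2] ZMod 2) := by
    intro x hxS
    have hx0 : x ≠ 0 := fun e => h0 (e ▸ hxS)
    have hev : Module.Dual.eval (ZMod 2) V x ≠ 0 := fun e =>
      hx0 ((Module.forall_dual_apply_eq_zero_iff (ZMod 2) x).1 fun f => by
        simpa using LinearMap.congr_fun e f)
    exact two_mul_hyperplaneWeight_univ (V := V →ₗ[ZMod 2] ZMod 2) hev
  have hdc : ∑ φ : V →ₗ[ZMod 2] ZMod 2, 2 * hyperplaneWeight S φ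
      = ∑ x ∈ S, 2 * (Finset.univ.filter fun φ : V →ₗ[ZMod 2] ZMod 2 => φ x = 1).card := by
    simp only [← Finset.mul_sum, hyperplaneWeight, Finset.card_filter]
    rw [Finset.sum_comm]
  rw [hdc, Finset.sum_congr rfl hx] at hlt
  simp only [Finset.sum_const, smul_eq_mul, Finset.card_univ] at hlt
  rw [mul_comm] at hlt
  exact lt_irrefl _ hlt

open scoped Classical in
theorem IsDivisibleSet.filter_ker {Δ : ℕ} {S : Finset V} (hS : IsDivisibleSet (2 * Δ) S)
    (φ : V →ₗ[ZMod 2] ZMod 2) : IsDivisibleSet Δ (S.filter fun x => ¬ φ x = 1) := by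
  intro ψ
  -- Pointwise: where `φ` is 1, exactly one of `ψ`, `φ + ψ` is 1; where `φ` is 0, they agree.
  have key : hyperplaneWeight S ψ + hyperplaneWeight S (φ + ψ)
      = 2 * hyperplaneWeight (S.filter fun x => ¬ φ x = 1) ψ + hyperplaneWeight S φ := by
    simp only [hyperplaneWeight, Finset.filter_filter, Finset.card_filter, Finset.mul_sum,
      ← Finset.sum_add_distrib, LinearMap.add_apply]
    refine Finset.sum_congr rfl fun x _ => ?_
    generalize φ x = a
    generalize ψ x = b
    rcases ZMod.two_eq_zero_or_one a with rfl | rfl <;>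
      rcases ZMod.two_eq_zero_or_one b with rfl | rfl <;> simp [show (1 : ZMod 2) + 1 = 0 by decide]
  have h : 2 * Δ ∣ 2 * hyperplaneWeight (S.filter fun x => ¬ φ x = 1) ψ :=
    (Nat.dvd_add_left (hS φ)).1 (key ▸ dvd_add (hS ψ) (hS (φ + ψ)))
  exact Nat.dvd_of_mul_dvd_mul_left two_pos h

/-- Some hyperplane contains fewer than half of the elements of a divisible set, and its
intersection with the set is divisible again. -/
theorem IsDivisibleSet.exists_subset [Finite V] {Δ : ℕ} {S : Finset V}
    (hS : IsDivisibleSet (2 * Δ) S) (h0 : (0 : V) ∉ S) (hne : S.Nonempty) :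
    ∃ T : Finset V, IsDivisibleSet Δ T ∧ (0 : V) ∉ T ∧ 2 * T.card < S.card ∧
      ∃ j, T.card + 2 * Δ * j = S.card := by
  classical
  obtain ⟨φ, hφ⟩ := exists_card_lt_two_mul_hyperplaneWeight h0 hne
  have hc : hyperplaneWeight S φ + (S.filter fun x => ¬ φ x = 1).card = S.card :=
    Finset.card_filter_add_card_filter_not (s := S) (fun x => φ x = 1)
  obtain ⟨j, hj⟩ := hS φ
  refine ⟨_, hS.filter_ker φ, fun h => h0 (Finset.mem_filter.1 h).1, by omega, j, by omega⟩

theorem IsDivisibleSet.card_ne_one [Finite V] {Δ : ℕ} {S : Finset V} (hΔ : 2 ≤ Δ)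
    (hS : IsDivisibleSet Δ S) (h0 : (0 : V) ∉ S) : S.card ≠ 1 := by
  classical
  intro h1
  obtain ⟨φ, hφ⟩ := exists_card_lt_two_mul_hyperplaneWeight h0 (Finset.card_pos.1 (by omega))
  have hle : hyperplaneWeight S φ ≤ S.card := Finset.card_filter_le _ _
  have := Nat.le_of_dvd (by omega) (hS φ)
  omega

theorem IsDivisibleSet.card_ne_two_mul_add_one [Finite V] {Δ : ℕ} {S : Finset V} (hΔ : 2 ≤ Δ)
    (hS : IsDivisibleSet (2 * Δ) S) (h0 : (0 : V) ∉ S) : S.card ≠ 2 * (2 * Δ) + 1 := by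
  intro h1
  obtain ⟨T, hT, hT0, hlt, j, hj⟩ := hS.exists_subset h0 (Finset.card_pos.1 (by omega))
  refine hT.card_ne_one hΔ hT0 ?_
  -- The bound `2 * T.card < S.card` leaves only `j = 2`, that is, `T.card = 1`.
  have hj2 : 2 ≤ j := by
    by_contra! h
    interval_cases j <;> omega
  have hj3 : j < 3 := by
    by_contra! h
    have := Nat.mul_le_mul_left (2 * Δ) h
    omega
  interval_cases j
  omega

theorem IsDivisibleSet.card_ne_four_mul_add_one [Finite V] {Δ : ℕ} {S : Finset V} (hΔ : 2 ≤ Δ)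
    (hS : IsDivisibleSet (2 * (2 * Δ)) S) (h0 : (0 : V) ∉ S) :
    S.card ≠ 4 * (2 * (2 * Δ)) + 1 := by
  intro h1
  obtain ⟨T, hT, hT0, hlt, j, hj⟩ := hS.exists_subset h0 (Finset.card_pos.1 (by omega))
  -- Only `j = 3` and `j = 4` survive, giving sizes `2 * (2 * Δ) + 1` and `1`.
  have hj3 : 3 ≤ j := by
    by_contra! h
    interval_cases j <;> omega
  have hj4 : j < 5 := by
    by_contra! h
    have := Nat.mul_le_mul_left (2 * (2 * Δ)) h
    omega
  interval_cases j
  · exact hT.card_ne_two_mul_add_one hΔ hT0 (by omega)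
  · exact hT.card_ne_one (by omega) hT0 (by omega)

open scoped Classical in
theorem isDivisibleSet_submodule [Fintype V] (U : Submodule (ZMod 2) V) {d : ℕ}
    (hd : Module.finrank (ZMod 2) U = d + 1) :
    IsDivisibleSet (2 ^ d) (Finset.univ.filter (· ∈ U)) := by
  intro φ
  have hw : hyperplaneWeight (Finset.univ.filter (· ∈ U)) φ
      = hyperplaneWeight (Finset.univ : Finset U) (φ.comp U.subtype) := by
    unfold hyperplaneWeight
    refine (Finset.card_bij (fun (x : U) _ => (x : V)) ?_ ?_ ?_).symm
    · intro x hx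
      exact Finset.mem_filter.2
        ⟨Finset.mem_filter.2 ⟨Finset.mem_univ _, x.2⟩, (Finset.mem_filter.1 hx).2⟩
    · intro x _ y _ h
      exact Subtype.ext h
    · intro x hx
      simp only [Finset.mem_filter, Finset.mem_univ, true_and] at hx
      exact ⟨⟨x, hx.1⟩, Finset.mem_filter.2 ⟨Finset.mem_univ _, hx.2⟩, rfl⟩
  rw [hw]
  by_cases h : φ.comp U.subtype = 0
  · rw [h]
    simp [hyperplaneWeight]
  · have h2 := two_mul_hyperplaneWeight_univ h
    rw [Module.card_eq_pow_finrank (K := ZMod 2), hd, ZMod.card, pow_succ, mul_comm] at h2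
    exact Dvd.intro 1 (by omega)

end Divisible

/-! ### Holes of a partial spread and the upper bound -/

section PartialSpread

open scoped Classical in
/-- The nonzero vectors that lie in no member of `C`. -/
noncomputable def holes {V : Type*} [AddCommGroup V] [Module (ZMod 2) V] [Fintype V]
    (C : Finset (Submodule (ZMod 2) V)) : Finset V :=
  Finset.univ.filter fun x => x ≠ 0 ∧ ∀ U ∈ C, x ∉ U

variable {V : Type*} [AddCommGroup V] [Module (ZMod 2) V] [Fintype V]
  {C : Finset (Submodule (ZMod 2) V)}

open scoped Classical in
/-- Nonzero vectors with a given property are partitioned by a partial spread and its holes. -/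
theorem card_filter_eq_sum_add_holes (hC : ∀ U ∈ C, ∀ W ∈ C, U ≠ W → U ⊓ W = ⊥)
    (p : V → Prop) [DecidablePred p] (hp : ¬ p 0) :
    (Finset.univ.filter p).card
      = ∑ U ∈ C, ((Finset.univ.filter (· ∈ U)).filter p).card + ((holes C).filter p).card := by
  have hdisj : ∀ U ∈ C, ∀ W ∈ C, U ≠ W →
      Disjoint ((Finset.univ.filter (· ∈ U)).filter p)
        ((Finset.univ.filter (· ∈ W)).filter p) := by
    intro U hU W hW hne
    refine Finset.disjoint_left.2 fun x hx hy => ?_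
    simp only [Finset.mem_filter, Finset.mem_univ, true_and] at hx hy
    have : x ∈ U ⊓ W := ⟨hx.1, hy.1⟩
    rw [hC U hU W hW hne, Submodule.mem_bot] at this
    exact hp (this ▸ hx.2)
  rw [← Finset.card_biUnion hdisj, ← Finset.card_union_of_disjoint]
  · congr 1
    ext x
    simp only [holes, Finset.mem_union, Finset.mem_biUnion, Finset.mem_filter, Finset.mem_univ,
      true_and]
    constructor
    · intro hx
      by_cases h : ∃ U ∈ C, x ∈ U
      · obtain ⟨U, hU, hxU⟩ := h
        exact Or.inl ⟨U, hU, hxU, hx⟩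
      · push Not at h
        exact Or.inr ⟨⟨fun e => hp (e ▸ hx), h⟩, hx⟩
    · rintro (⟨U, _, _, hx⟩ | ⟨_, hx⟩) <;> exact hx
  · refine Finset.disjoint_left.2 fun x hx hy => ?_
    simp only [holes, Finset.mem_biUnion, Finset.mem_filter, Finset.mem_univ, true_and] at hx hy
    obtain ⟨U, hU, hxU, _⟩ := hx
    exact hy.1.2 U hU hxU

/-- The whole space and every member are divisible, and weights are additive over the partition; the
shared zero vector never counts. -/
theorem isDivisibleSet_holes {d : ℕ} (hV : d + 1 ≤ Module.finrank (ZMod 2) V)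
    (hd : ∀ U ∈ C, Module.finrank (ZMod 2) U = d + 1)
    (hC : ∀ U ∈ C, ∀ W ∈ C, U ≠ W → U ⊓ W = ⊥) : IsDivisibleSet (2 ^ d) (holes C) := by
  classical
  intro φ
  have h := card_filter_eq_sum_add_holes hC (fun x => φ x = 1) (by simp)
  obtain ⟨e, he⟩ := Nat.exists_eq_add_of_le hV
  have htop : 2 ^ d ∣ hyperplaneWeight Finset.univ φ := by
    have := isDivisibleSet_submodule (⊤ : Submodule (ZMod 2) V) (d := d + e)
      (by rw [finrank_top]; omega) φ
    simp only [Submodule.mem_top, Finset.filter_true] at this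
    exact (pow_dvd_pow 2 (Nat.le_add_right d e)).trans this
  have hsum : 2 ^ d ∣ ∑ U ∈ C,
      ((Finset.univ.filter (· ∈ U)).filter fun x => φ x = 1).card :=
    Finset.dvd_sum fun U hU => isDivisibleSet_submodule U (hd U hU) φ
  unfold hyperplaneWeight at htop
  rw [h] at htop
  exact (Nat.dvd_add_right hsum).1 htop

theorem card_holes {k : ℕ} (hd : ∀ U ∈ C, Module.finrank (ZMod 2) U = k)
    (hC : ∀ U ∈ C, ∀ W ∈ C, U ≠ W → U ⊓ W = ⊥) :
    2 ^ Module.finrank (ZMod 2) V - 1 = C.card * (2 ^ k - 1) + (holes C).card := by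
  classical
  have h := card_filter_eq_sum_add_holes hC (fun x => x ≠ 0) (by simp)
  have hU : ∀ U ∈ C, ((Finset.univ.filter (· ∈ U)).filter fun x : V => x ≠ 0).card
      = 2 ^ k - 1 := by
    intro U hU
    have hcard : (Finset.univ.filter (· ∈ U)).card = 2 ^ k := by
      rw [← Fintype.card_subtype]
      have := Module.card_eq_pow_finrank (K := ZMod 2) (V := U)
      rw [hd U hU, ZMod.card] at this
      rw [← this]
    rw [Finset.filter_ne', Finset.card_erase_of_mem (by simp), hcard]
  rw [Finset.sum_congr rfl hU, Finset.sum_const, smul_eq_mul, Finset.filter_ne',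
    Finset.card_erase_of_mem (Finset.mem_univ _), Finset.card_univ,
    Module.card_eq_pow_finrank (K := ZMod 2), ZMod.card] at h
  rw [h, Finset.filter_true_of_mem]
  intro x hx
  exact (Finset.mem_filter.1 hx).2.1

theorem card_partialSpread_le {k : ℕ} (hk : 4 ≤ k)
    (hV : Module.finrank (ZMod 2) V = 2 * k + 2)
    (hd : ∀ U ∈ C, Module.finrank (ZMod 2) U = k)
    (hC : ∀ U ∈ C, ∀ W ∈ C, U ≠ W → U ⊓ W = ⊥) : C.card ≤ 2 ^ (k + 2) + 1 := by
  by_contra! hlt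
  -- Discarding surplus members fixes the number of holes exactly.
  obtain ⟨D, hDC, hD⟩ := Finset.exists_subset_card_eq (n := 2 ^ (k + 2) + 2) hlt
  have hd' : ∀ U ∈ D, Module.finrank (ZMod 2) U = k := fun U hU => hd U (hDC hU)
  have hC' : ∀ U ∈ D, ∀ W ∈ D, U ≠ W → U ⊓ W = ⊥ :=
    fun U hU W hW => hC U (hDC hU) W (hDC hW)
  have hcard := card_holes hd' hC'
  obtain ⟨m, rfl⟩ := Nat.exists_eq_add_of_le' hk
  have hdiv := isDivisibleSet_holes (d := m + 3) (by omega) hd' hC'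
  rw [show 2 ^ (m + 3) = 2 * (2 * 2 ^ (m + 1)) by ring] at hdiv
  refine hdiv.card_ne_four_mul_add_one ?_ (by simp [holes]) ?_
  · rw [pow_succ]
    have := Nat.one_le_two_pow (n := m)
    omega
  · rw [hV, hD] at hcard
    have h1 := Nat.one_le_two_pow (n := m)
    rw [show 2 * (m + 4) + 2 = m + m + 10 by ring, pow_add, pow_add] at hcard
    rw [show m + 4 + 2 = m + 6 by ring, pow_add, pow_add] at hcard
    rw [pow_add]
    generalize 2 ^ m = a at *
    obtain ⟨b, rfl⟩ := Nat.exists_eq_add_of_le' h1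
    have e1 : (b + 1) * 2 ^ 4 - 1 = 16 * b + 15 := by omega
    have e2 : (b + 1) * (b + 1) * 2 ^ 10 - 1 = 1024 * b ^ 2 + 2048 * b + 1023 := by
      have : (b + 1) * (b + 1) * 2 ^ 10 = 1024 * b ^ 2 + 2048 * b + 1023 + 1 := by ring
      omega
    rw [e1, e2] at hcard
    nlinarith [hcard]

end PartialSpread

/-! ### Subspace distance and the construction -/

theorem subspaceDist_eq_of_disjoint {K : Type*} [Field K] {n k : ℕ}
    {U W : Submodule K (Fin n → K)} (hU : Module.finrank K U = k) (hW : Module.finrank K W = k)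
    (h : U ⊓ W = ⊥) : subspaceDist U W = 2 * k := by
  have := Submodule.finrank_sup_add_finrank_inf_eq U W
  unfold subspaceDist
  rw [h, finrank_bot] at *
  omega

theorem inf_eq_bot_of_le_subspaceDist {K : Type*} [Field K] {n k : ℕ}
    {U W : Submodule K (Fin n → K)} (hU : Module.finrank K U = k) (hW : Module.finrank K W = k)
    (h : 2 * k ≤ subspaceDist U W) : U ⊓ W = ⊥ := by
  have := Submodule.finrank_sup_add_finrank_inf_eq U W
  unfold subspaceDist at h
  rw [← Submodule.finrank_eq_zero (R := K)]
  by_cases hk : k = 0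
  · have := Submodule.finrank_mono (inf_le_left : U ⊓ W ≤ U)
    omega
  · omega

/-- A space `K × L`, with `L` a field extension of `K` and `W` a `K`-subspace of `L`, contains a
partial spread: the graphs over `W` of the multiplications by elements of `L`, and a subspace
of `0 × L`. -/
theorem exists_partialSpread (K L : Type*) [Field K] [Field L] [Algebra K L] [Fintype L]
    [FiniteDimensional K L] (W : Submodule K L) (hW : W ≠ ⊥) :
    ∃ C : Finset (Submodule K (W × L)), C.card = Fintype.card L + 1 ∧
      (∀ U ∈ C, Module.finrank K U = Module.finrank K W) ∧
      ∀ U ∈ C, ∀ U' ∈ C, U ≠ U' → U ⊓ U' = ⊥ := by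
  classical
  let g : Option L → (W →ₗ[K] W × L) := fun o =>
    o.elim (LinearMap.prod 0 W.subtype)
      fun a => LinearMap.prod LinearMap.id ((LinearMap.mulLeft K a).comp W.subtype)
  have hinj : ∀ o, Function.Injective (g o) := by
    rintro (_ | a) x y h
    · exact Subtype.ext (congrArg Prod.snd h)
    · exact congrArg Prod.fst h
  have hdisj : ∀ o o', o ≠ o' → LinearMap.range (g o) ⊓ LinearMap.range (g o') = ⊥ := by
    intro o o' hne
    rw [eq_bot_iff]
    rintro z ⟨⟨x, hx⟩, ⟨y, hy⟩⟩
    rw [Submodule.mem_bot]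
    have hxy : g o x = g o' y := hx.trans hy.symm
    rcases o with _ | a <;> rcases o' with _ | b
    · exact absurd rfl hne
    · have h1 : (0 : W) = y := congrArg Prod.fst hxy
      rw [← hy, ← h1, map_zero]
    · have h1 : x = (0 : W) := congrArg Prod.fst hxy
      rw [← hx, h1, map_zero]
    · have h1 : x = y := congrArg Prod.fst hxy
      have h2 : a * (x : L) = b * (y : L) := congrArg Prod.snd hxy
      subst h1
      have hab : a ≠ b := fun e => hne (congrArg some e)
      have hx0 : (x : L) = 0 := by
        by_contra h0
        exact hab (mul_right_cancel₀ h0 h2)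
      rw [← hx, show x = 0 from Subtype.ext hx0, map_zero]
  have hfin : ∀ o, Module.finrank K (LinearMap.range (g o)) = Module.finrank K W := fun o =>
    LinearMap.finrank_range_of_inj (hinj o)
  -- Trivially intersecting subspaces are distinct only when nonzero, hence `W ≠ ⊥`.
  have hRinj : Function.Injective fun o => LinearMap.range (g o) := by
    intro o o' h
    by_contra hne
    have h1 := hdisj o o' hne
    have h2 : LinearMap.range (g o) = LinearMap.range (g o') := h
    rw [← h2, inf_idem] at h1
    have h3 := hfin o
    rw [h1, finrank_bot] at h3
    exact hW (Submodule.finrank_eq_zero.1 h3.symm)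
  refine ⟨Finset.univ.image fun o => LinearMap.range (g o), ?_, ?_, ?_⟩
  · rw [Finset.card_image_of_injective _ hRinj, Finset.card_univ, Fintype.card_option]
  · intro U hU
    obtain ⟨o, -, rfl⟩ := Finset.mem_image.1 hU
    exact hfin o
  · intro U hU U' hU' hne
    obtain ⟨o, -, rfl⟩ := Finset.mem_image.1 hU
    obtain ⟨o', -, rfl⟩ := Finset.mem_image.1 hU'
    exact hdisj o o' fun e => hne (e ▸ rfl)

theorem exists_isSubspaceCode_card {k m : ℕ} (hk : k ≠ 0) (hkm : k ≤ m) :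
    ∃ C : Finset (Submodule (ZMod 2) (Fin (k + m) → ZMod 2)),
      IsSubspaceCode (ZMod 2) (k + m) (2 * k) {k} C ∧ C.card = 2 ^ m + 1 := by
  classical
  have hm : m ≠ 0 := by omega
  let _ := Fintype.ofFinite (GaloisField 2 m)
  have hL : Module.finrank (ZMod 2) (GaloisField 2 m) = m := GaloisField.finrank 2 hm
  obtain ⟨W, hW⟩ : ∃ W : Submodule (ZMod 2) (GaloisField 2 m), Module.finrank (ZMod 2) W = k :=
    (exists_linearIndependent_of_le_finrank (hkm.trans hL.ge)).elim fun f hf =>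
      ⟨Submodule.span (ZMod 2) (Set.range f), by rw [finrank_span_eq_card hf, Fintype.card_fin]⟩
  have hW0 : W ≠ ⊥ := by
    rintro rfl
    rw [finrank_bot] at hW
    exact hk hW.symm
  obtain ⟨C, hcard, hd, hC⟩ := exists_partialSpread (ZMod 2) (GaloisField 2 m) W hW0
  have e : (W × GaloisField 2 m) ≃ₗ[ZMod 2] (Fin (k + m) → ZMod 2) :=
    LinearEquiv.ofFinrankEq _ _ (by rw [Module.finrank_prod, hW, hL, Module.finrank_fin_fun])
  have hdim : ∀ U ∈ C, Module.finrank (ZMod 2) (U.map e.toLinearMap) = k := fun U hU => by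
    rw [LinearEquiv.finrank_map_eq, hd U hU, hW]
  refine ⟨C.image fun U => U.map e.toLinearMap, ⟨?_, ?_⟩, ?_⟩
  · intro U hU
    obtain ⟨P, hP, rfl⟩ := Finset.mem_image.1 hU
    exact hdim P hP
  · intro U hU U' hU' hne
    obtain ⟨P, hP, rfl⟩ := Finset.mem_image.1 hU
    obtain ⟨P', hP', rfl⟩ := Finset.mem_image.1 hU'
    refine (subspaceDist_eq_of_disjoint (hdim P hP) (hdim P' hP') ?_).ge
    rw [← Submodule.map_inf _ e.injective, hC P hP P' hP' fun h => hne (h ▸ rfl),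
      Submodule.map_bot]
  · rw [Finset.card_image_of_injective _ (Submodule.map_injective_of_injective e.injective), hcard,
      ← Nat.card_eq_fintype_card, GaloisField.card 2 m hm]

theorem mainTheorem3 (k : ℕ) (hk : 4 ≤ k) :
    maxSubspaceCode (ZMod 2) (2 * k + 2) (2 * k) {k} = 2 ^ (k + 2) + 1 := by
  refine (isGreatest_maxSubspaceCode (ZMod 2) (2 * k + 2) (2 * k) {k}).unique ⟨?_, ?_⟩
  · have h := exists_isSubspaceCode_card (k := k) (m := k + 2) (by omega) (by omega)
    rwa [show k + (k + 2) = 2 * k + 2 by ring] at h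
  · rintro N ⟨C, ⟨hd, hdist⟩, rfl⟩
    exact card_partialSpread_le hk (Module.finrank_fin_fun _) hd fun U hU W hW hne =>
      inf_eq_bot_of_le_subspaceDist (hd U hU) (hd W hW) (hdist U hU W hW hne)
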